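/- For a function $f$ on the upper half-plane $\mathbb{H}$ write $D(f)=\frac{1}{2\pi i}\frac{df}{d\tau}=q\frac{df}{dq}$, where $q=e^{2\pi i\tau}$ and $q^{r}=e^{2\pi i r\tau}$ for $r\in\mathbb{Q}$, and let $E_k$ denote the normalized Eisenstein series of weight $k$ on $SL_2(\mathbb{Z})$ (with constant term $1$). For $s\in\mathbb{C}$ let $(\flat_s)$ be the modular linear differential equation $$D^4(f)-E_2D^3(f)+\bigl(3D(E_2)+\alpha_1(s)E_4\bigr)D^2(f)-\Bigl(D^2(E_2)+\tfrac{\alpha_1(s)}{2}D(E_4)-\alpha_2(s)E_6\Bigr)D(f)+\alpha_3(s)E_8f=0,$$ where $$\alpha_1(s)=\frac{-25s^2+120s+1332}{7200},\qquad \alpha_2(s)=\frac{(5s+6)^2}{14400},\qquad \alpha_3(s)=\frac{(s-18)(s+6)(5s+6)^2}{8294400}.$$ A function $f$ on $\mathbb{H}$ has exponent $\alpha\in\mathbb{Q}$ if $f(\tau)=q^{\alpha}\sum_{n\ge 0}a_nq^n$ on $\mathbb{H}$ with $a_n\in\mathbb{C}$ and $a_0\neq 0$. It is of character type if it has such an expansion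 (for some rational exponent) in which all $a_n$ are non-negative integers and $a_0\ge 1$, and of CFT type if moreover $a_0=1$. A space of functions on $\mathbb{H}$ is modular invariant if it is stable under $h(\tau)\mapsto h\bigl(\frac{a\tau+b}{c\tau+d}\bigr)$ for all $\begin{pmatrix}a&b\\c&d\end{pmatrix}\in SL_2(\mathbb{Z})$. **Proposition.** Let $s$ be one of the numbers $-\frac35,\frac25,\frac65,\frac{12}5,\frac{18}5,\frac{22}5,\frac{27}5,6,\frac{32}5$. Let $f$ and $g$ be linearly independent holomorphic solutions on $\mathbb{H}$ of $(\flat_s)$ with exponents $\alpha\in\mathbb{Q}$ and $\beta\in\mathbb{Q}$ respectively. Suppose that $\beta-\alpha=\frac45$, that $f$ is of CFT type, that $g$ is of character type, and that the space spanned by $f$ and $g$ is modular invariant. Then $s=\frac{32}5$. -/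

import Mathlib

open scoped UpperHalfPlane MatrixGroups ModularForm Manifold

namespace FourthOrderMLDE

noncomputable section

/-- The differential operator `D = (2πi)⁻¹ d/dτ = q d/dq` on functions on the upper half-plane. -/
abbrev qD : (ℍ → ℂ) → (ℍ → ℂ) := Derivative.normalizedDerivOfComplex

/-- The normalized Eisenstein series of weight 8. -/
abbrev E₈ : ModularForm 𝒮ℒ 8 := ModularForm.E (by norm_num : 3 ≤ 8)

/-- The coefficient `α₁(s)`. -/
def coeff₁ (s : ℂ) : ℂ := (-25 * s ^ 2 + 120 * s + 1332) / 7200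

/-- The coefficient `α₂(s)`. -/
def coeff₂ (s : ℂ) : ℂ := (5 * s + 6) ^ 2 / 14400

/-- The coefficient `α₃(s)`. -/
def coeff₃ (s : ℂ) : ℂ := (s - 18) * (s + 6) * (5 * s + 6) ^ 2 / 8294400

/-- The left-hand side of the fourth order modular linear differential equation `(♭_s)`
of weight 0. -/
def flatOperator (s : ℂ) (f : ℍ → ℂ) (τ : ℍ) : ℂ :=
  qD^[4] f τ
    - EisensteinSeries.E2 τ * qD^[3] f τ
    + (3 * qD EisensteinSeries.E2 τ + coeff₁ s * ModularForm.E₄ τ) * qD^[2] f τ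
    - (qD^[2] EisensteinSeries.E2 τ + coeff₁ s / 2 * qD ModularForm.E₄ τ
        - coeff₂ s * ModularForm.E₆ τ) * qD f τ
    + coeff₃ s * E₈ τ * f τ

/-- `f` is a (holomorphic) solution of `(♭_s)` on the upper half-plane. -/
def IsFlatSolution (s : ℂ) (f : ℍ → ℂ) : Prop :=
  MDiff f ∧ ∀ τ : ℍ, flatOperator s f τ = 0

/-- `f(τ) = q^α ∑_{n ≥ 0} a_n q^n` on the upper half-plane, where
`q^r = exp(2πi r τ)` for rational `r`. -/
def HasQSeries (f : ℍ → ℂ) (α : ℚ) (a : ℕ → ℂ) : Prop :=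
  ∀ τ : ℍ, HasSum
    (fun n : ℕ ↦ a n * Complex.exp (2 * Real.pi * Complex.I * ((α : ℂ) + n) * (τ : ℂ))) (f τ)

/-- `f` has exponent `α`: it has a `q`-series `q^α ∑ a_n q^n` with non-zero leading
coefficient `a_0`. -/
def HasExponent (f : ℍ → ℂ) (α : ℚ) : Prop :=
  ∃ a : ℕ → ℂ, a 0 ≠ 0 ∧ HasQSeries f α a

/-- `f` is of CFT type: `f = q^α (1 + ∑_{n ≥ 1} a_n q^n)` with `α` rational and all `a_n`
non-negative integers. -/
def IsOfCFTType (f : ℍ → ℂ) : Prop :=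
  ∃ (α : ℚ) (a : ℕ → ℕ), a 0 = 1 ∧ HasQSeries f α (fun n ↦ (a n : ℂ))

/-- `f` is of character type: `f = q^β ∑_{n ≥ 0} a_n q^n` with `β` rational, all `a_n`
non-negative integers and `a_0 ≥ 1`. -/
def IsOfCharacterType (f : ℍ → ℂ) : Prop :=
  ∃ (β : ℚ) (a : ℕ → ℕ), 1 ≤ a 0 ∧ HasQSeries f β (fun n ↦ (a n : ℂ))

/-- A space of functions on the upper half-plane is modular invariant if it is stable under
the weight 0 slash action of `SL(2, ℤ)`. -/
def IsModularInvariant (U : Submodule ℂ (ℍ → ℂ)) : Prop :=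
  ∀ γ : SL(2, ℤ), ∀ h ∈ U, h ∣[(0 : ℤ)] γ ∈ U

end

end FourthOrderMLDE

namespace FourthOrderMLDE

open Function UpperHalfPlane Filter Topology

/-! Put x = (5s+6)/120. Comparing lowest-order terms in (♭_s) shows that every exponent of a
solution is one of -x, x, x + 1/5, 4/5 - x (`indicial_eq_zero`, `indicial_eq_prod`). Modular
invariance bounds the sum of the exponents (`exponent_add_le`): the Wronskian of f and g has weight
2 up to a character and starts at q^(α+β). Its sixth power is a nonzero holomorphic form of weight
12 and level one, so it cannot vanish at i∞ to order greater than one, and 6(α+β) ≤ 1. The pair α =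
-x, β = 4/5 - x has sum 4/5 - 2x, which is at most 1/6 exactly when s ≥ 32/5. For the smaller listed
s every other pair with difference 4/5 is excluded too (`eq_of_indicial`). -/

/-! ### Calculus of q-expansions. -/

/-- `f(τ) = q^r F(q)` on the upper half-plane, with `F` holomorphic on the open unit disc. -/
def IsQAnalytic (r : ℂ) (F : ℂ → ℂ) (f : ℍ → ℂ) : Prop :=
  DifferentiableOn ℂ F (Metric.ball 0 1) ∧
    ∀ τ : ℍ, f τ = Complex.exp (2 * Real.pi * Complex.I * r * τ) * F (Periodic.qParam 1 τ)

lemma qParam_one_mem_ball (τ : ℍ) : Periodic.qParam 1 (τ : ℂ) ∈ Metric.ball (0 : ℂ) 1 := by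
  simpa using Periodic.norm_qParam_lt_one one_pos τ.im_pos

lemma IsQAnalytic.tendsto {r : ℂ} {F : ℂ → ℂ} {f : ℍ → ℂ} (h : IsQAnalytic r F f) :
    Tendsto (fun τ : ℍ ↦ F (Periodic.qParam 1 τ)) atImInfty (𝓝 (F 0)) :=
  (h.1.differentiableAt (Metric.ball_mem_nhds 0 one_pos)).continuousAt.tendsto.comp
    (qParam_tendsto_atImInfty one_pos)

lemma IsQAnalytic.apply_zero_eq_zero {r : ℂ} {F : ℂ → ℂ} (h : IsQAnalytic r F 0) : F 0 = 0 := by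
  refine tendsto_nhds_unique h.tendsto (tendsto_const_nhds.congr fun τ ↦ ?_)
  exact ((mul_eq_zero.mp (h.2 τ).symm).resolve_left (Complex.exp_ne_zero _)).symm

lemma IsQAnalytic.add {r : ℂ} {F G : ℂ → ℂ} {f g : ℍ → ℂ} (hf : IsQAnalytic r F f)
    (hg : IsQAnalytic r G g) : IsQAnalytic r (F + G) (f + g) :=
  ⟨hf.1.add hg.1, fun τ ↦ by simp only [Pi.add_apply, hf.2, hg.2]; ring⟩

lemma IsQAnalytic.sub {r : ℂ} {F G : ℂ → ℂ} {f g : ℍ → ℂ} (hf : IsQAnalytic r F f)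
    (hg : IsQAnalytic r G g) : IsQAnalytic r (F - G) (f - g) :=
  ⟨hf.1.sub hg.1, fun τ ↦ by simp only [Pi.sub_apply, hf.2, hg.2]; ring⟩

lemma IsQAnalytic.smul {r : ℂ} {F : ℂ → ℂ} {f : ℍ → ℂ} (c : ℂ) (hf : IsQAnalytic r F f) :
    IsQAnalytic r (c • F) (c • f) :=
  ⟨hf.1.const_smul c, fun τ ↦ by simp only [Pi.smul_apply, hf.2, smul_eq_mul]; ring⟩

lemma IsQAnalytic.mul {r s : ℂ} {F G : ℂ → ℂ} {f g : ℍ → ℂ} (hf : IsQAnalytic r F f)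
    (hg : IsQAnalytic s G g) : IsQAnalytic (r + s) (F * G) (f * g) := by
  refine ⟨hf.1.mul hg.1, fun τ ↦ ?_⟩
  simp only [Pi.mul_apply, hf.2, hg.2, mul_add, add_mul, Complex.exp_add]
  ring

lemma IsQAnalytic.pow {r : ℂ} {F : ℂ → ℂ} {f : ℍ → ℂ} (hf : IsQAnalytic r F f) (n : ℕ) :
    IsQAnalytic (n * r) (F ^ n) (f ^ n) := by
  refine ⟨hf.1.pow n, fun τ ↦ ?_⟩
  simp only [Pi.pow_apply, hf.2, mul_pow, ← Complex.exp_nat_mul]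
  ring_nf

/-- Product rule for q^r F(q). At q = 0 the new factor takes the value r F(0), so each `qD`
multiplies the leading coefficient by r. -/
lemma IsQAnalytic.qD {r : ℂ} {F : ℂ → ℂ} {f : ℍ → ℂ} (hf : IsQAnalytic r F f) :
    IsQAnalytic r (fun q ↦ r * F q + q * deriv F q) (qD f) := by
  refine ⟨(hf.1.const_mul r).add (differentiableOn_id.mul (hf.1.deriv Metric.isOpen_ball)),
    fun τ ↦ ?_⟩
  have hF : HasDerivAt F (deriv F (Periodic.qParam 1 τ)) (Periodic.qParam 1 τ) :=
    (hf.1.differentiableAt (Metric.isOpen_ball.mem_nhds (qParam_one_mem_ball τ))).hasDerivAt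
  have hq : HasDerivAt (Periodic.qParam 1)
      (2 * Real.pi * Complex.I * Periodic.qParam 1 τ) (τ : ℂ) := by
    have := ((hasDerivAt_id (τ : ℂ)).const_mul (2 * Real.pi * Complex.I)).cexp
    have heq : Periodic.qParam 1 = fun z ↦ Complex.exp (2 * Real.pi * Complex.I * z) := by
      ext; simp [Periodic.qParam]
    rw [heq]
    simpa [mul_comm] using this
  have he : HasDerivAt (fun z : ℂ ↦ Complex.exp (2 * Real.pi * Complex.I * r * z))
      (2 * Real.pi * Complex.I * r * Complex.exp (2 * Real.pi * Complex.I * r * τ)) (τ : ℂ) := by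
    have := ((hasDerivAt_id (τ : ℂ)).const_mul (2 * Real.pi * Complex.I * r)).cexp
    simpa [mul_comm] using this
  have heq : f ∘ ofComplex =ᶠ[𝓝 (τ : ℂ)] fun z ↦
      Complex.exp (2 * Real.pi * Complex.I * r * z) * F (Periodic.qParam 1 z) := by
    filter_upwards [isOpen_upperHalfPlaneSet.mem_nhds τ.im_pos] with z hz
    simp only [Function.comp_apply, hf.2, ofComplex_apply_of_im_pos hz]
  have hd := (he.mul (hF.comp (τ : ℂ) hq)).congr_of_eventuallyEq heq
  rw [FourthOrderMLDE.qD, Derivative.normalizedDerivOfComplex, hd.deriv]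
  simp only [Function.comp_apply]
  field [Complex.I_ne_zero, Real.pi_ne_zero]

lemma exists_isQAnalytic_of_hasSum {f : ℍ → ℂ} {c : ℕ → ℂ} (hf : MDiff f)
    (h : ∀ τ : ℍ, HasSum (fun m ↦ c m • Periodic.qParam 1 τ ^ m) (f τ)) :
    ∃ F, IsQAnalytic 0 F f ∧ F 0 = c 0 := by
  have hper : Periodic (f ∘ ofComplex) (1 : ℝ) := by
    intro z
    by_cases hz : 0 < z.im
    · have hz' : 0 < (z + (1 : ℝ)).im := by simpa using hz
      have h1 := h ⟨z, hz⟩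
      have h2 := h ⟨z + (1 : ℝ), hz'⟩
      rw [show Periodic.qParam 1 ((⟨z + (1 : ℝ), hz'⟩ : ℍ) : ℂ)
        = Periodic.qParam 1 ((⟨z, hz⟩ : ℍ) : ℂ) by
          simp [Periodic.qParam, mul_add, Complex.exp_add, Complex.exp_two_pi_mul_I]] at h2
      simpa only [Function.comp_apply, ofComplex_apply_of_im_pos hz,
        ofComplex_apply_of_im_pos hz'] using h2.unique h1
    -- Off the upper half-plane `ofComplex` is a constant default value, so periodicity holds there
    -- as well.
    · have hz' : (z + (1 : ℝ)).im ≤ 0 := by simpa using hz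
      simp only [Function.comp_apply, ofComplex_apply_of_im_nonpos (not_lt.mp hz),
        ofComplex_apply_of_im_nonpos hz']
  have hbdd := isBoundedAtImInfty_of_hasSum_qExpansion one_pos h
  refine ⟨cuspFunction 1 f, ⟨differentiableOn_cuspFunction_ball one_pos hper hf hbdd,
    fun τ ↦ by simp [eq_cuspFunction τ one_ne_zero hper]⟩, ?_⟩
  have := (hasFPowerSeriesOnBall_cuspFunction one_pos
    (analyticAt_cuspFunction_zero one_pos hper hf hbdd) h).hasFPowerSeriesAt.coeff_zero
    (fun _ ↦ 0)
  simpa using this.symm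

lemma HasQSeries.exists_isQAnalytic {f : ℍ → ℂ} {α : ℚ} {a : ℕ → ℂ} (hf : MDiff f)
    (h : HasQSeries f α a) : ∃ F, IsQAnalytic α F f ∧ F 0 = a 0 := by
  have hexp : MDiff (fun τ : ℍ ↦ Complex.exp (-(2 * Real.pi * Complex.I * α * τ))) := by
    rw [UpperHalfPlane.mdifferentiable_iff]
    refine DifferentiableOn.congr (f := fun z : ℂ ↦
      Complex.exp (-(2 * Real.pi * Complex.I * α * z))) (by fun_prop) fun z hz ↦ ?_
    simp [ofComplex_apply_of_im_pos hz]
  -- Multiplying by q^(-α) leaves a series in integral powers of q.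
  obtain ⟨F, hF, hF0⟩ := exists_isQAnalytic_of_hasSum (c := a) (hexp.mul hf) fun τ ↦ by
    convert! (h τ).mul_left (Complex.exp (-(2 * Real.pi * Complex.I * α * τ))) using 2 with n
    rw [mul_left_comm, ← Complex.exp_add, Periodic.qParam, ← Complex.exp_nat_mul, smul_eq_mul]
    congr 2
    push_cast
    ring
  refine ⟨F, ⟨hF.1, fun τ ↦ ?_⟩, hF0⟩
  have := hF.2 τ
  simp only [mul_zero, zero_mul, Complex.exp_zero, one_mul, Pi.mul_apply] at this
  rw [← this, ← mul_assoc, ← Complex.exp_add]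
  simp

lemma HasExponent.exists_isQAnalytic {f : ℍ → ℂ} {α : ℚ} (hf : MDiff f)
    (h : HasExponent f α) : ∃ F, IsQAnalytic α F f ∧ F 0 ≠ 0 := by
  obtain ⟨a, ha, h⟩ := h
  obtain ⟨F, hF, hF0⟩ := h.exists_isQAnalytic hf
  exact ⟨F, hF, hF0 ▸ ha⟩

lemma exists_isQAnalytic_E2 : ∃ F, IsQAnalytic 0 F EisensteinSeries.E2 ∧ F 0 = 1 := by
  obtain ⟨F, hF, hF0⟩ := exists_isQAnalytic_of_hasSum E2_mdifferentiable fun τ ↦ by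
    simpa only [Periodic.qParam, Complex.ofReal_one, div_one] using
      EisensteinSeries.hasSum_qExpansion_E2 (z := τ)
  exact ⟨F, hF, hF0.trans (if_pos rfl)⟩

lemma exists_isQAnalytic_E {k : ℕ} (hk : 3 ≤ k) (hk2 : Even k) :
    ∃ F, IsQAnalytic 0 F (ModularForm.E hk) ∧ F 0 = 1 := by
  rw [← EisensteinSeries.E_qExpansion_coeff_zero hk hk2]
  exact exists_isQAnalytic_of_hasSum (ModularFormClass.holo (ModularForm.E hk))
    (ModularForm.hasSum_qExpansion (ModularForm.E hk) one_pos one_mem_strictPeriods_SL)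

/-! ### The indicial equation. -/

/-- An exponent of a solution of `(♭_s)` is a root of the indicial polynomial. -/
lemma indicial_eq_zero {s : ℂ} {f : ℍ → ℂ} {α : ℚ} (hf : IsFlatSolution s f)
    (h : HasExponent f α) :
    (α : ℂ) ^ 4 - α ^ 3 + coeff₁ s * α ^ 2 + coeff₂ s * α + coeff₃ s = 0 := by
  obtain ⟨F, hF, hF0⟩ := h.exists_isQAnalytic hf.1
  obtain ⟨F₂, h₂, h₂0⟩ := exists_isQAnalytic_E2
  obtain ⟨F₄, h₄, h₄0⟩ := exists_isQAnalytic_E (by norm_num : 3 ≤ 4) (by decide)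
  obtain ⟨F₆, h₆, h₆0⟩ := exists_isQAnalytic_E (by norm_num : 3 ≤ 6) (by decide)
  obtain ⟨F₈, h₈, h₈0⟩ := exists_isQAnalytic_E (by norm_num : 3 ≤ 8) (by decide)
  have key := (((hF.qD.qD.qD.qD.sub ((zero_add (α : ℂ)) ▸ h₂.mul hF.qD.qD.qD)).add
    ((zero_add (α : ℂ)) ▸ ((h₂.qD.smul 3).add (h₄.smul (coeff₁ s))).mul hF.qD.qD)).sub
    ((zero_add (α : ℂ)) ▸ ((h₂.qD.qD.add (h₄.qD.smul (coeff₁ s / 2))).sub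
      (h₆.smul (coeff₂ s))).mul hF.qD)).add
    ((zero_add (α : ℂ)) ▸ (h₈.smul (coeff₃ s)).mul hF)
  have hzero := IsQAnalytic.apply_zero_eq_zero (h := by
    convert! key
    ext τ
    exact (hf.2 τ).symm)
  -- At q = 0 each Eisenstein series is 1 and its derivatives are 0, leaving the indicial polynomial
  -- at α times F(0).
  simp only [Pi.add_apply, Pi.sub_apply, Pi.mul_apply, Pi.smul_apply, smul_eq_mul, zero_mul,
    mul_zero, add_zero, h₂0, h₄0, h₆0, h₈0] at hzero
  refine (mul_eq_zero.mp (?_ : _ * F 0 = 0)).resolve_right hF0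
  linear_combination hzero

/-- The indicial polynomial of `(♭_s)` splits into linear factors. -/
lemma indicial_eq_prod (s x : ℂ) :
    x ^ 4 - x ^ 3 + coeff₁ s * x ^ 2 + coeff₂ s * x + coeff₃ s =
      (x + (5 * s + 6) / 120) * (x - (5 * s + 6) / 120) * (x - ((5 * s + 6) / 120 + 1 / 5)) *
        (x - (4 / 5 - (5 * s + 6) / 120)) := by
  simp only [coeff₁, coeff₂, coeff₃]
  ring

/-! ### The Wronskian and the bound on the exponents. -/

/-- The Wronskian of `f` and `g`. -/
noncomputable def wronskian (f g : ℍ → ℂ) : ℍ → ℂ := f * qD g - g * qD f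

lemma wronskian_mdifferentiable {f g : ℍ → ℂ} (hf : MDiff f) (hg : MDiff g) :
    MDiff (wronskian f g) :=
  (hf.mul (Derivative.normalizedDerivOfComplex_mdifferentiable hg)).sub
    (hg.mul (Derivative.normalizedDerivOfComplex_mdifferentiable hf))

/-- `qD` intertwines the slash actions of weights 0 and 2, so the Wronskian is multiplied by the
determinant of the matrix by which γ acts on f and g. -/
lemma wronskian_slash_eq_smul {f g : ℍ → ℂ} (hf : MDiff f) (hg : MDiff g)
    (hinv : IsModularInvariant (Submodule.span ℂ {f, g})) (γ : SL(2, ℤ)) :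
    ∃ c : ℂ, wronskian f g ∣[(2 : ℤ)] γ = c • wronskian f g := by
  obtain ⟨a, b, hab⟩ := Submodule.mem_span_pair.mp
    (hinv γ f (Submodule.subset_span (by simp)))
  obtain ⟨c, d, hcd⟩ := Submodule.mem_span_pair.mp
    (hinv γ g (Submodule.subset_span (by simp)))
  have hD {h : ℍ → ℂ} (hh : MDiff h) : qD h ∣[(2 : ℤ)] γ = qD (h ∣[(0 : ℤ)] γ) := by
    rw [qD, Derivative.normalizedDerivOfComplex_SL_slash hh]
    ext; simp
  have hlin (x y : ℂ) : qD (x • f + y • g) = x • qD f + y • qD g := by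
    rw [qD, Derivative.normalizedDerivOfComplex_add _ _ (hf.const_smul x) (hg.const_smul y),
      Derivative.normalizedDerivOfComplex_smul _ _ hf,
      Derivative.normalizedDerivOfComplex_smul _ _ hg]
  have hmul (u v : ℍ → ℂ) : (u * v) ∣[(2 : ℤ)] γ = u ∣[(0 : ℤ)] γ * v ∣[(2 : ℤ)] γ := by
    simpa using ModularForm.mul_slash_SL2 0 2 γ u v
  refine ⟨a * d - b * c, ?_⟩
  rw [wronskian, sub_eq_add_neg, SlashAction.add_slash, SlashAction.neg_slash, hmul, hmul, hD hf,
    hD hg, ← hab, ← hcd, hlin, hlin]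
  ext τ
  simp only [Pi.add_apply, Pi.neg_apply, Pi.mul_apply, Pi.smul_apply, smul_eq_mul]
  ring

/-- A nonzero function of weight 2 on which `SL(2, ℤ)` acts through a character has
a sixth power that is invariant of weight 12. -/
lemma pow_six_slash_eq {W : ℍ → ℂ} (hW : W ≠ 0)
    (h : ∀ γ : SL(2, ℤ), ∃ c : ℂ, W ∣[(2 : ℤ)] γ = c • W) (γ : SL(2, ℤ)) :
    (W ^ 6) ∣[(12 : ℤ)] γ = W ^ 6 := by
  choose χ hχ using h
  have hinj {x y : ℂ} (hxy : x • W = y • W) : x = y := smul_left_injective ℂ hW hxy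
  have hmul (A B : SL(2, ℤ)) : χ (A * B) = χ A * χ B := hinj <| by
    rw [← hχ, SlashAction.slash_mul, hχ, ModularForm.SL_smul_slash, hχ, smul_smul]
  have hone : χ 1 = 1 := hinj <| by rw [← hχ, SlashAction.slash_one, one_smul]
  have hneg : χ (-1) = 1 := hinj <| by
    rw [← hχ, one_smul]
    ext τ
    simp [ModularForm.SL_slash_apply, denom]
  have hpow (γ : SL(2, ℤ)) (hγ : χ γ ^ 6 = 1) : (W ^ 6) ∣[(12 : ℤ)] γ = W ^ 6 := by
    have h2 : ∀ n : ℕ, (W ^ n) ∣[(2 * n : ℤ)] γ = χ γ ^ n • W ^ n := by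
      intro n
      induction n with
      | zero => ext τ; simp [ModularForm.SL_slash_apply]
      | succ n ih =>
        rw [pow_succ, Nat.cast_succ, mul_add, mul_one, ModularForm.mul_slash_SL2, ih, hχ]
        ext τ
        simp only [Pi.mul_apply, Pi.smul_apply, smul_eq_mul]
        ring
    simpa [hγ] using h2 6
  -- The relations S² = (ST)³ = -1, with χ(-1) = 1 because the weight is even, force χ⁶ = 1 on both
  -- generators.
  have hS : χ ModularGroup.S ^ 2 = 1 := by
    rw [pow_two, ← hmul, ← hneg]
    congr 1
    ext i j
    fin_cases i <;> fin_cases j <;> rfl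
  have hST : (χ ModularGroup.S * χ ModularGroup.T) ^ 3 = 1 := by
    rw [← hmul, pow_succ, pow_two, ← hmul, ← hmul, ← hneg]
    congr 1
    ext i j
    fin_cases i <;> fin_cases j <;> rfl
  refine SlashInvariantForm.slash_action_generators_SL2Z (hpow _ ?_) (hpow _ ?_) γ
  · linear_combination (χ ModularGroup.S ^ 4 + χ ModularGroup.S ^ 2 + 1) * hS
  · have h6 : (χ ModularGroup.S ^ 2) ^ 3 * χ ModularGroup.T ^ 6 = 1 := by
      linear_combination ((χ ModularGroup.S * χ ModularGroup.T) ^ 3 + 1) * hST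
    simpa [hS] using h6

/-- F(q) stays bounded at i∞, while |q^r| = o(|q|) for r > 1. -/
lemma IsQAnalytic.isLittleO {r : ℝ} (hr : 1 < r) {F : ℂ → ℂ} {f : ℍ → ℂ}
    (h : IsQAnalytic r F f) :
    f =o[atImInfty] fun τ ↦ Real.exp (-2 * Real.pi * τ.im) := by
  have him : Tendsto UpperHalfPlane.im atImInfty atTop := tendsto_comap
  have hexp : (fun τ : ℍ ↦ Complex.exp (2 * Real.pi * Complex.I * r * τ)) =o[atImInfty]
      fun τ ↦ Real.exp (-2 * Real.pi * τ.im) := by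
    rw [← Asymptotics.isLittleO_norm_left]
    have hn (τ : ℍ) : ‖Complex.exp (2 * Real.pi * Complex.I * r * τ)‖ =
        Real.exp (-2 * Real.pi * r * τ.im) := by
      simp [Complex.norm_exp]
    simp only [hn]
    rw [Real.isLittleO_exp_comp_exp_comp]
    refine (him.const_mul_atTop (r := 2 * Real.pi * (r - 1)) ?_).congr fun τ ↦ by ring
    have := sub_pos.mpr hr
    positivity
  have := hexp.mul_isBigO (h.tendsto.isBigO_one ℝ)
  simp only [mul_one] at this
  exact this.congr_left fun τ ↦ (h.2 τ).symm

/-- A level one modular function of weight 12 vanishing at `i∞` to order greater than one is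
zero. -/
lemma eq_zero_of_weight_twelve {W : ℍ → ℂ} (hW : MDiff W)
    (hinv : ∀ γ : SL(2, ℤ), W ∣[(12 : ℤ)] γ = W)
    (ho : W =o[atImInfty] fun τ ↦ Real.exp (-2 * Real.pi * τ.im)) : W = 0 := by
  have hzero : IsZeroAtImInfty W := by
    refine ho.trans_tendsto (Real.tendsto_exp_atBot.comp ?_)
    exact (tendsto_comap : Tendsto UpperHalfPlane.im atImInfty atTop).const_mul_atTop_of_neg
      (by linarith [Real.pi_pos])
  let C : CuspForm 𝒮ℒ 12 :=
    { toFun := W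
      slash_action_eq' := by
        rintro _ ⟨γ, rfl⟩
        exact hinv γ
      holo' := hW
      zero_at_cusps' := fun hc ↦ by
        rw [Subgroup.IsArithmetic.isCusp_iff_isCusp_SL2Z] at hc
        rw [OnePoint.isZeroAt_iff_forall_SL2Z hc]
        intro γ _
        -- All cusps are equivalent to i∞ under SL(2, ℤ), so invariance reduces vanishing at each of
        -- them to `hzero`.
        rw [hinv]
        exact hzero }
  obtain ⟨c, hc⟩ := CuspForm.exists_smul_discriminant_of_weight_eq_twelve C
  have hW_eq : c • ModularForm.discriminant = W := congrArg DFunLike.coe hc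
  suffices c = 0 by rw [← hW_eq, this, zero_smul]
  by_contra hc0
  -- Since q = O(Δ) at i∞, W = cΔ with c ≠ 0 would give Δ = o(Δ), although Δ has no zeros.
  have h1 : ModularForm.discriminant =o[atImInfty] ModularForm.discriminant := by
    have := ho.trans_isBigO ModularForm.exp_isBigO_discriminant
    rw [← hW_eq] at this
    exact (Asymptotics.isLittleO_const_smul_left hc0).mp this
  exact Asymptotics.isLittleO_irrefl
    (Frequently.of_forall ModularForm.discriminant_ne_zero) h1

/-- The distinct exponents of a basis of a two-dimensional modular invariant space of
holomorphic functions have sum at most `1 / 6`. -/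
lemma exponent_add_le {f g : ℍ → ℂ} {α β : ℚ} (hf : MDiff f) (hg : MDiff g)
    (hfα : HasExponent f α) (hgβ : HasExponent g β) (hne : α ≠ β)
    (hinv : IsModularInvariant (Submodule.span ℂ {f, g})) : α + β ≤ 1 / 6 := by
  obtain ⟨F, hF, hF0⟩ := hfα.exists_isQAnalytic hf
  obtain ⟨G, hG, hG0⟩ := hgβ.exists_isQAnalytic hg
  have hW := (hF.mul hG.qD).sub ((add_comm (β : ℂ) α) ▸ hG.mul hF.qD)
  change IsQAnalytic _ _ (wronskian f g) at hW
  have hW0 : wronskian f g ≠ 0 := by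
    intro h0
    -- The leading coefficient of the Wronskian is (β - α)F(0)G(0).
    have := (h0 ▸ hW).apply_zero_eq_zero
    simp only [Pi.sub_apply, Pi.mul_apply, zero_mul, add_zero] at this
    have h1 : ((β : ℂ) - α) * (F 0 * G 0) = 0 := by linear_combination this
    refine hne (Eq.symm ?_)
    exact_mod_cast sub_eq_zero.mp ((mul_eq_zero.mp h1).resolve_right (mul_ne_zero hF0 hG0))
  by_contra! hlt
  have hr : (1 : ℝ) < 6 * (α + β) := by
    have : (1 : ℚ) < 6 * (α + β) := by linarith
    exact_mod_cast this
  refine hW0 (pow_eq_zero_iff (n := 6) (by norm_num) |>.mp ?_)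
  refine eq_zero_of_weight_twelve ((wronskian_mdifferentiable hf hg).pow 6)
    (pow_six_slash_eq hW0 (wronskian_slash_eq_smul hf hg hinv)) ?_
  have h6 := hW.pow 6
  rw [show ((6 : ℕ) : ℂ) * (α + β) = ((6 * (α + β) : ℝ) : ℂ) by push_cast; ring] at h6
  exact h6.isLittleO hr

/-! ### Comparison of the exponents. -/

/-- Two exponents of `(♭_s)` differing by `4 / 5`, with sum at most `1 / 6`, force
`s = 32 / 5` for the parameters in the list. -/
lemma eq_of_indicial {s : ℂ}
    (hs : s ∈ ({-3 / 5, 2 / 5, 6 / 5, 12 / 5, 18 / 5, 22 / 5, 27 / 5, 6, 32 / 5} : Set ℂ))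
    {α β : ℚ} (hαβ : β - α = 4 / 5) (hle : α + β ≤ 1 / 6)
    (hα : (α : ℂ) ^ 4 - α ^ 3 + coeff₁ s * α ^ 2 + coeff₂ s * α + coeff₃ s = 0)
    (hβ : (β : ℂ) ^ 4 - β ^ 3 + coeff₁ s * β ^ 2 + coeff₂ s * β + coeff₃ s = 0) :
    s = 32 / 5 := by
  obtain ⟨t, ht, rfl⟩ : ∃ t : ℚ, t ∈ ({-3 / 5, 2 / 5, 6 / 5, 12 / 5, 18 / 5, 22 / 5, 27 / 5, 6,
      32 / 5} : Set ℚ) ∧ (t : ℂ) = s := by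
    simp only [Set.mem_insert_iff, Set.mem_singleton_iff] at hs
    rcases hs with rfl | rfl | rfl | rfl | rfl | rfl | rfl | rfl | rfl
    exacts [⟨-3 / 5, by simp⟩, ⟨2 / 5, by simp⟩, ⟨6 / 5, by simp⟩, ⟨12 / 5, by simp⟩,
      ⟨18 / 5, by simp⟩, ⟨22 / 5, by simp⟩, ⟨27 / 5, by simp⟩, ⟨6, by simp⟩, ⟨32 / 5, by simp⟩]
  obtain rfl : β = α + 4 / 5 := by linarith
  rw [indicial_eq_prod] at hα hβ
  replace hα : (α + (5 * t + 6) / 120) * (α - (5 * t + 6) / 120) *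
      (α - ((5 * t + 6) / 120 + 1 / 5)) * (α - (4 / 5 - (5 * t + 6) / 120)) = 0 := by
    rw [← Rat.cast_inj (α := ℂ)]
    push_cast
    exact hα
  replace hβ : (α + 4 / 5 + (5 * t + 6) / 120) * (α + 4 / 5 - (5 * t + 6) / 120) *
      (α + 4 / 5 - ((5 * t + 6) / 120 + 1 / 5)) *
        (α + 4 / 5 - (4 / 5 - (5 * t + 6) / 120)) = 0 := by
    rw [← Rat.cast_inj (α := ℂ)]
    push_cast at hβ ⊢
    exact hβ
  suffices t = 32 / 5 by rw [this]; norm_num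
  by_contra hne
  have hlow : -3 / 5 ≤ t := by
    rcases ht with rfl | rfl | rfl | rfl | rfl | rfl | rfl | rfl | rfl <;> norm_num
  have hupp : t ≤ 6 := by
    rcases ht with rfl | rfl | rfl | rfl | rfl | rfl | rfl | rfl | rfl <;>
      first | exact absurd rfl hne | norm_num
  simp only [mul_eq_zero] at hα hβ
  -- With x = (5t+6)/120, the bounds give 1/40 ≤ x ≤ 3/10. Only (-x, 4/5 - x), and at x = 3/10 also
  -- (-x, x + 1/5), have difference 4/5; their sums are at least 1/5 > 1/6.
  rcases hα with ((hα | hα) | hα) | hα <;> rcases hβ with ((hβ | hβ) | hβ) | hβ <;> linarith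

end FourthOrderMLDE

theorem mainTheorem7 (s : ℂ)
    (hs : s ∈ ({-3 / 5, 2 / 5, 6 / 5, 12 / 5, 18 / 5, 22 / 5, 27 / 5, 6, 32 / 5} : Set ℂ))
    (f g : ℍ → ℂ) (α β : ℚ)
    (hf : FourthOrderMLDE.IsFlatSolution s f) (hg : FourthOrderMLDE.IsFlatSolution s g)
    (hfg : LinearIndependent ℂ ![f, g])
    (hfα : FourthOrderMLDE.HasExponent f α) (hgβ : FourthOrderMLDE.HasExponent g β)
    (hαβ : β - α = 4 / 5)
    (hfCFT : FourthOrderMLDE.IsOfCFTType f) (hgchar : FourthOrderMLDE.IsOfCharacterType g)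
    (hinv : FourthOrderMLDE.IsModularInvariant (Submodule.span ℂ {f, g})) :
    s = 32 / 5 :=
  FourthOrderMLDE.eq_of_indicial hs hαβ
    (FourthOrderMLDE.exponent_add_le hf.1 hg.1 hfα hgβ (by rintro rfl; norm_num at hαβ) hinv)
    (FourthOrderMLDE.indicial_eq_zero hf hfα) (FourthOrderMLDE.indicial_eq_zero hg hgβ)
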